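/- Let $A_1,A_2$ be finite nonempty sets, $m\in\mathbb N$, and $u:A_1\times A_2\to\mathbb R^m$, extended bilinearly to pairs of mixed actions in $\Delta(A_1)\times\Delta(A_2)$; $\mathbb R^m$ carries the Euclidean norm $\|\cdot\|$. *Continuous time.* A control of player $i$ is a measurable function $a_i:[0,\infty)\to\Delta(A_i)$; let $\mathcal C_i$ be the set of these controls. A strategy (behavior strategy with delay) of player $i$ is a map $\sigma_i:\mathcal C_{-i}\to\mathcal C_i$, where $-i$ denotes the other player, for which there are times $0=\tau^0<\tau^1<\tau^2<\cdots$ with $\tau^k\to\infty$ such that for all $b,b'\in\mathcal C_{-i}$ and all $k\ge 0$: if $b=b'$ on $[0,\tau^k)$, then $\sigma_i(b)=\sigma_i(b')$ on $[0,\tau^{k+1})$. A pair $(\sigma_1,\sigma_2)$ determines a unique play path $(a_1,a_2)$ with $a_1=\sigma_1(a_2)$ and $a_2=\sigma_2(a_1)$, and we put $\gamma^t(\sigma_1,\sigma_2)=\int_0^t u(a_1(s),a_2(s))\,ds$. The vector $\vec 0$ is *attainable* by Player 1 if there is $T>0$ such that for every $\varepsilon>0$ there is a strategy $\sigma_1$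 of Player 1 with $\|\gamma^t(\sigma_1,\sigma_2)\|\le\varepsilon$ for all $t\ge T$ and all strategies $\sigma_2$ of Player 2. *Discrete time.* In the repeated game with payoff function $u$, a (behavior) strategy of a player assigns a mixed action to each finite history of action pairs; at every stage the two players randomize independently given the history, so a pair of strategies $(f,g)$ induces a probability measure $P_{f,g}$ on infinite sequences $(a_1^i,a_2^i)_{i\ge1}$ of action pairs. The vector $\vec 0$ is *approachable* by Player 1 (in Blackwell's sense) if Player 1 has a strategy $f$ such that for every $\varepsilon>0$ there is $N$ such that for every strategy $g$ of Player 2, $$P_{f,g}\Big(\exists\, n\ge N:\ \Big\|\tfrac1n\sum_{i=1}^n u(a_1^i,a_2^i)\Big\|\ge\varepsilon\Big)<\varepsilon .$$ **Corollary.** The vector $\vec 0$ is attainable by Player 1 in the continuous-time game if and only if it is approachable by Player 1 in the discrete-time repeated game with payoff function $u$. -/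

import Mathlib

open MeasureTheory ProbabilityTheory Filter
open scoped NNReal ENNReal

namespace VectorGame

/-- The set `Δ(A)` of mixed actions over a finite action set `A`. -/
abbrev MixedAction (A : Type*) [Fintype A] : Type _ := stdSimplex ℝ A

/-- Bilinear extension of a vector payoff function to pairs of mixed actions. -/
noncomputable def mixedPayoff {A₁ A₂ : Type*} [Fintype A₁] [Fintype A₂] {m : ℕ}
    (u : A₁ → A₂ → EuclideanSpace ℝ (Fin m)) (p : MixedAction A₁) (q : MixedAction A₂) :
    EuclideanSpace ℝ (Fin m) :=
  ∑ a, ∑ b, (p a * q b) • u a b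

/-! ### The game in continuous time -/

/-- Controls of a player with action set `A`: measurable functions `[0, ∞) → Δ(A)`. -/
def Control (A : Type*) [Fintype A] : Type _ :=
  {a : ℝ≥0 → MixedAction A // Measurable a}

/-- The mixed action chosen by a control at time `t`. -/
def Control.at {A : Type*} [Fintype A] (a : Control A) (t : ℝ≥0) : MixedAction A := a.1 t

/-- Behavior strategies with delay of a player with action set `A` whose opponent has action
set `B`. The updating times increase to infinity, so that the blocks `[τ k, τ (k + 1))` cover the
whole time line. -/
structure DelayStrategy (A B : Type*) [Fintype A] [Fintype B] where
  /-- The response to a control of the opponent. -/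
  respond : Control B → Control A
  /-- Existence of updating times. -/
  delay : ∃ τ : ℕ → ℝ≥0, τ 0 = 0 ∧ StrictMono τ ∧ Tendsto τ atTop atTop ∧
    ∀ b b' : Control B, ∀ k : ℕ, (∀ t < τ k, b.at t = b'.at t) →
      ∀ t < τ (k + 1), (respond b).at t = (respond b').at t

/-- `(a₁, a₂)` is a play path of the strategy pair `(σ₁, σ₂)`: each control is the response
to the other one. -/
def IsPlay {A₁ A₂ : Type*} [Fintype A₁] [Fintype A₂] (σ₁ : DelayStrategy A₁ A₂)
    (σ₂ : DelayStrategy A₂ A₁) (a : Control A₁ × Control A₂) : Prop :=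
  a.1 = σ₁.respond a.2 ∧ a.2 = σ₂.respond a.1

section Play

variable {A₁ A₂ : Type*} [Fintype A₁] [Fintype A₂]

/-- Agreement of two pairs of controls on `[0, s)`. -/
def Agree (x y : Control A₁ × Control A₂) (s : ℝ≥0) : Prop :=
  ∀ t < s, x.1.at t = y.1.at t ∧ x.2.at t = y.2.at t

def step (σ₁ : DelayStrategy A₁ A₂) (σ₂ : DelayStrategy A₂ A₁)
    (x : Control A₁ × Control A₂) : Control A₁ × Control A₂ :=
  (σ₁.respond x.2, σ₂.respond x.1)

theorem exists_iterate_agree (σ₁ : DelayStrategy A₁ A₂) (σ₂ : DelayStrategy A₂ A₁)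
    (T : ℝ≥0) : ∃ n : ℕ, ∀ x y, Agree ((step σ₁ σ₂)^[n] x) ((step σ₁ σ₂)^[n] y) T := by
  obtain ⟨τ, τ0, hτ, hτt, hσ₁⟩ := σ₁.delay
  obtain ⟨ρ, ρ0, hρ, hρt, hσ₂⟩ := σ₂.delay
  have key : ∀ N k l : ℕ, k + l ≤ N → ∃ n : ℕ, ∀ x y,
      Agree ((step σ₁ σ₂)^[n] x) ((step σ₁ σ₂)^[n] y) (min (τ k) (ρ l)) := by
    intro N
    induction N with
    | zero =>
      intro k l h
      obtain rfl : k = 0 := by omega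
      exact ⟨0, fun x y t ht => absurd ht (by simp [τ0])⟩
    | succ N ih =>
      intro k l h
      rcases k with _ | k
      · exact ⟨0, fun x y t ht => absurd ht (by simp [τ0])⟩
      rcases l with _ | l
      · exact ⟨0, fun x y t ht => absurd ht (by simp [ρ0])⟩
      have adv : (∃ n : ℕ, ∀ x y, Agree ((step σ₁ σ₂)^[n] x) ((step σ₁ σ₂)^[n] y)
            (max (τ k) (ρ l))) → ∃ n : ℕ, ∀ x y,
          Agree ((step σ₁ σ₂)^[n] x) ((step σ₁ σ₂)^[n] y) (min (τ (k + 1)) (ρ (l + 1))) := by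
        rintro ⟨n, hn⟩
        refine ⟨n + 1, fun x y t ht => ?_⟩
        rw [Function.iterate_succ_apply', Function.iterate_succ_apply']
        exact ⟨hσ₁ _ _ k (fun s hs => (hn x y s (lt_max_of_lt_left hs)).2) t
            (lt_of_lt_of_le ht (min_le_left _ _)),
          hσ₂ _ _ l (fun s hs => (hn x y s (lt_max_of_lt_right hs)).1) t
            (lt_of_lt_of_le ht (min_le_right _ _))⟩
      have i1 := ih k (l + 1) (by omega)
      have i2 := ih (k + 1) l (by omega)
      have hk := hτ (Nat.lt_succ_self k)
      have hl := hρ (Nat.lt_succ_self l)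
      rcases le_total (ρ (l + 1)) (τ k) with h1 | h1
      · rw [min_eq_right h1] at i1
        rwa [min_eq_right (h1.trans hk.le)]
      rcases le_total (τ (k + 1)) (ρ l) with h2 | h2
      · rw [min_eq_left h2] at i2
        rwa [min_eq_left (h2.trans hl.le)]
      apply adv
      rw [min_eq_left h1] at i1
      rw [min_eq_right h2] at i2
      rcases le_total (τ k) (ρ l) with h3 | h3
      · rwa [max_eq_right h3]
      · rwa [max_eq_left h3]
  obtain ⟨k, hk⟩ := (hτt.eventually_ge_atTop T).exists
  obtain ⟨l, hl⟩ := (hρt.eventually_ge_atTop T).exists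
  obtain ⟨n, hn⟩ := key _ k l le_rfl
  exact ⟨n, fun x y t ht => hn x y t (lt_of_lt_of_le ht (le_min hk hl))⟩

/-- Every pair of strategies has exactly one play path. -/
theorem existsUnique_isPlay [Nonempty A₁] [Nonempty A₂] (σ₁ : DelayStrategy A₁ A₂)
    (σ₂ : DelayStrategy A₂ A₁) : ∃! a : Control A₁ × Control A₂, IsPlay σ₁ σ₂ a := by
  set F := step σ₁ σ₂ with hF
  have fix : ∀ a, IsPlay σ₁ σ₂ a ↔ F a = a := fun a =>
    ⟨fun h => Prod.ext h.1.symm h.2.symm,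
      fun h => ⟨(congrArg Prod.fst h).symm, (congrArg Prod.snd h).symm⟩⟩
  choose N hN using exists_iterate_agree σ₁ σ₂
  let p₁ : MixedAction A₁ := Classical.arbitrary _
  let p₂ : MixedAction A₂ := Classical.arbitrary _
  let x₀ : Control A₁ × Control A₂ := (⟨fun _ => p₁, measurable_const⟩, ⟨fun _ => p₂, measurable_const⟩)
  have stab : ∀ (T : ℝ≥0) (n : ℕ), N T ≤ n → Agree (F^[n] x₀) (F^[N T] x₀) T := by
    intro T n hn
    obtain ⟨j, rfl⟩ := Nat.exists_eq_add_of_le hn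
    rw [Function.iterate_add_apply]
    exact hN T _ _
  have lim₁ : Measurable fun t => (F^[N (t + 1)] x₀).1.at t := by
    refine measurable_of_tendsto_metrizable (fun n => (F^[n] x₀).1.2) ?_
    refine tendsto_pi_nhds.2 fun t => tendsto_const_nhds.congr' ?_
    filter_upwards [eventually_ge_atTop (N (t + 1))] with n hn
    exact (stab _ n hn t (lt_add_one t)).1.symm
  have lim₂ : Measurable fun t => (F^[N (t + 1)] x₀).2.at t := by
    refine measurable_of_tendsto_metrizable (fun n => (F^[n] x₀).2.2) ?_
    refine tendsto_pi_nhds.2 fun t => tendsto_const_nhds.congr' ?_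
    filter_upwards [eventually_ge_atTop (N (t + 1))] with n hn
    exact (stab _ n hn t (lt_add_one t)).2.symm
  let a : Control A₁ × Control A₂ := (⟨_, lim₁⟩, ⟨_, lim₂⟩)
  have agr : ∀ (T : ℝ≥0) (n : ℕ), N T ≤ n → Agree a (F^[n] x₀) T := by
    intro T n hn t ht
    have h1 := stab _ _ (le_max_left (N (t + 1)) n) t (lt_add_one t)
    have h2 := stab T _ (hn.trans (le_max_right (N (t + 1)) n)) t ht
    have h3 := stab T n hn t ht
    exact ⟨h1.1.symm.trans (h2.1.trans h3.1.symm), h1.2.symm.trans (h2.2.trans h3.2.symm)⟩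
  have eqOf : ∀ x y : Control A₁ × Control A₂, (∀ T, Agree x y T) → x = y := fun x y h =>
    Prod.ext (Subtype.ext (funext fun t => (h (t + 1) t (lt_add_one t)).1))
      (Subtype.ext (funext fun t => (h (t + 1) t (lt_add_one t)).2))
  refine ⟨a, (fix a).2 (eqOf _ _ fun T t ht => ?_), fun b hb => eqOf _ _ fun T => ?_⟩
  · obtain ⟨τ, -, hτ, hτt, hσ₁⟩ := σ₁.delay
    obtain ⟨ρ, -, hρ, hρt, hσ₂⟩ := σ₂.delay
    obtain ⟨k, hk⟩ := (hτt.eventually_gt_atTop t).exists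
    obtain ⟨l, hl⟩ := (hρt.eventually_gt_atTop t).exists
    set n := max (N (t + 1)) (max (N (τ k)) (N (ρ l)))
    have hn := agr (t + 1) (n + 1) (by omega) t (lt_add_one t)
    rw [Function.iterate_succ_apply'] at hn
    refine ⟨Eq.trans ?_ hn.1.symm, Eq.trans ?_ hn.2.symm⟩
    · exact hσ₁ _ _ k (fun s hs => (agr (τ k) n (by omega) s hs).2) t (hk.trans (hτ k.lt_succ_self))
    · exact hσ₂ _ _ l (fun s hs => (agr (ρ l) n (by omega) s hs).1) t (hl.trans (hρ l.lt_succ_self))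
  · have hb' := Function.iterate_fixed ((fix b).1 hb) (N T)
    intro t ht
    have h1 := hN T b x₀ t ht
    have h2 := agr T (N T) le_rfl t ht
    rw [← hF, hb'] at h1
    exact ⟨h1.1.trans h2.1.symm, h1.2.trans h2.2.symm⟩

end Play

/-- The play path determined by a pair of strategies. -/
noncomputable def play {A₁ A₂ : Type*} [Fintype A₁] [Fintype A₂] [Nonempty A₁] [Nonempty A₂]
    (σ₁ : DelayStrategy A₁ A₂) (σ₂ : DelayStrategy A₂ A₁) : Control A₁ × Control A₂ :=
  (existsUnique_isPlay σ₁ σ₂).choose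

theorem play_isPlay {A₁ A₂ : Type*} [Fintype A₁] [Fintype A₂] [Nonempty A₁] [Nonempty A₂]
    (σ₁ : DelayStrategy A₁ A₂) (σ₂ : DelayStrategy A₂ A₁) : IsPlay σ₁ σ₂ (play σ₁ σ₂) :=
  (existsUnique_isPlay σ₁ σ₂).choose_spec.1

/-- The cumulative payoff up to time `t`. -/
noncomputable def cumulativePayoff {A₁ A₂ : Type*} [Fintype A₁] [Fintype A₂] [Nonempty A₁]
    [Nonempty A₂] {m : ℕ} (u : A₁ → A₂ → EuclideanSpace ℝ (Fin m))
    (σ₁ : DelayStrategy A₁ A₂) (σ₂ : DelayStrategy A₂ A₁) (t : ℝ) : EuclideanSpace ℝ (Fin m) :=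
  ∫ s in (0 : ℝ)..t,
    mixedPayoff u ((play σ₁ σ₂).1.at s.toNNReal) ((play σ₁ σ₂).2.at s.toNNReal)

/-- The vector `x` is attainable by Player 1 in the continuous-time game with payoff `u`. -/
def Attainable {A₁ A₂ : Type*} [Fintype A₁] [Fintype A₂] [Nonempty A₁] [Nonempty A₂] {m : ℕ}
    (u : A₁ → A₂ → EuclideanSpace ℝ (Fin m)) (x : EuclideanSpace ℝ (Fin m)) : Prop :=
  ∃ T : ℝ, 0 < T ∧ ∀ ε : ℝ, 0 < ε → ∃ σ₁ : DelayStrategy A₁ A₂,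
    ∀ t : ℝ, T ≤ t → ∀ σ₂ : DelayStrategy A₂ A₁, dist (cumulativePayoff u σ₁ σ₂ t) x ≤ ε

/-! ### The repeated game in discrete time -/

/-- Behavior strategies in the discrete-time game with action sets `A₁`, `A₂`, for a player whose
own action set is `C`: a mixed action after every finite history of action pairs. -/
abbrev DiscreteStrategy (A₁ A₂ C : Type*) [Fintype C] : Type _ :=
  (n : ℕ) → (Fin n → A₁ × A₂) → MixedAction C

/-- A mixed action as a probability measure. -/
noncomputable def mixedMeasure {A : Type*} [Fintype A] [MeasurableSpace A] (p : MixedAction A) :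
    Measure A :=
  ∑ a, ENNReal.ofReal (p a) • Measure.dirac a

instance {A : Type*} [Fintype A] [MeasurableSpace A] (p : MixedAction A) :
    IsProbabilityMeasure (mixedMeasure p) := by
  constructor
  have h : ∑ a, ENNReal.ofReal (p a) = 1 :=
    (ENNReal.ofReal_sum_of_nonneg (fun a _ => p.2.1 a)).symm.trans
      ((congrArg ENNReal.ofReal p.2.2).trans ENNReal.ofReal_one)
  simpa [mixedMeasure] using h

/-- The average payoff over the first `n` stages. -/
noncomputable def averagePayoff {A₁ A₂ : Type*} {m : ℕ}
    (u : A₁ → A₂ → EuclideanSpace ℝ (Fin m)) (n : ℕ) (w : ℕ → A₁ × A₂) : EuclideanSpace ℝ (Fin m) :=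
  (n : ℝ)⁻¹ • ∑ i ∈ Finset.range n, u (w i).1 (w i).2

section Discrete

variable {A₁ A₂ : Type*} [Fintype A₁] [Fintype A₂]
  [MeasurableSpace A₁] [DiscreteMeasurableSpace A₁]
  [MeasurableSpace A₂] [DiscreteMeasurableSpace A₂]

/-- The law of the action pair played after the history `h`: the players randomize
independently. -/
noncomputable def stageMeasure (f : DiscreteStrategy A₁ A₂ A₁) (g : DiscreteStrategy A₁ A₂ A₂)
    (n : ℕ) (h : Fin n → A₁ × A₂) : Measure (A₁ × A₂) :=
  (mixedMeasure (f n h)).prod (mixedMeasure (g n h))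

instance (f : DiscreteStrategy A₁ A₂ A₁) (g : DiscreteStrategy A₁ A₂ A₂)
    (n : ℕ) (h : Fin n → A₁ × A₂) : IsProbabilityMeasure (stageMeasure f g n h) := by
  unfold stageMeasure; infer_instance

/-- The transition kernel from the first `n + 1` action pairs to the next one. -/
noncomputable def stageKernel (f : DiscreteStrategy A₁ A₂ A₁) (g : DiscreteStrategy A₁ A₂ A₂)
    (n : ℕ) : Kernel (Π _ : Finset.Iic n, A₁ × A₂) (A₁ × A₂) :=
  Kernel.ofFunOfCountable fun h => stageMeasure f g (n + 1)
    fun i => h ⟨i, Finset.mem_Iic.2 (Nat.le_of_lt_succ i.2)⟩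

instance (f : DiscreteStrategy A₁ A₂ A₁) (g : DiscreteStrategy A₁ A₂ A₂) (n : ℕ) :
    IsMarkovKernel (stageKernel f g n) :=
  ⟨fun _ => inferInstanceAs (IsProbabilityMeasure (stageMeasure f g (n + 1) _))⟩

/-- The law of the infinite sequence of action pairs induced by a pair of strategies. -/
noncomputable def playLaw (f : DiscreteStrategy A₁ A₂ A₁) (g : DiscreteStrategy A₁ A₂ A₂) :
    Measure (ℕ → A₁ × A₂) :=
  Kernel.trajMeasure (X := fun _ => A₁ × A₂) (stageMeasure f g 0 Fin.elim0) (stageKernel f g)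

/-- The vector `x` is approachable (in the sense of Blackwell) by Player 1 in the discrete-time
repeated game with payoff `u`. -/
def Approachable {m : ℕ} (u : A₁ → A₂ → EuclideanSpace ℝ (Fin m))
    (x : EuclideanSpace ℝ (Fin m)) : Prop :=
  ∃ f : DiscreteStrategy A₁ A₂ A₁, ∀ ε : ℝ, 0 < ε → ∃ N : ℕ,
    ∀ g : DiscreteStrategy A₁ A₂ A₂,
      playLaw f g {w | ∃ n, N ≤ n ∧ ε ≤ dist (averagePayoff u n w) x} < ENNReal.ofReal ε

end Discrete

end VectorGame

/-! Both properties are equivalent to Blackwell's condition: for every direction `x` Player 1 has a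
mixed action `p` with `⟪x, u(p, q)⟫ ≤ 0` for all `q`.

Necessity. If the condition fails, separation of convex sets (`exists_separating_action`) gives `x`,
a mixed action `q` and `c > 0` with `⟪x, u(p, q)⟫ ≥ c` for all `p`. By always playing `q`, Player 2
makes the payoff drift at rate at least `c` in direction `x`, deterministically in continuous time
and in mean in discrete time. This contradicts attainability and approachability alike.

Sufficiency. Player 1 answers the current cumulative payoff `x` with a mixed action that is good
against `x`. When the square is expanded, the cross term is nonpositive (in mean, in discrete time),
so the squared norm grows by at most `C ^ 2` times the squared length of the step. In continuous
time the steps may shrink: block lengths `δ / (i + 1)` have infinite sum but summable squares, so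
the cumulative payoff itself stays within `ε` at all times (`norm_sq_integral_blockStrategy_le`). In
discrete time the steps have length 1, so the mean of `‖S_n‖ ^ 2` is at most `n * C ^ 2`. A maximal
inequality for a stopped supermartingale then controls all late averages at once, uniformly in
Player 2's strategy (`measureReal_exceedance_le`). -/

namespace VectorGame

/-! ### Blackwell's condition and its dual -/

section Payoff

variable {A₁ A₂ : Type*} [Fintype A₁] [Fintype A₂] {m : ℕ}

/-- Blackwell's condition for the origin: against every direction `x` Player 1 has a mixed action
which keeps the payoff in the half-space opposite to `x`. -/
def BlackwellCondition (u : A₁ → A₂ → EuclideanSpace ℝ (Fin m)) : Prop :=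
  ∀ x : EuclideanSpace ℝ (Fin m), ∃ p : MixedAction A₁, ∀ q : MixedAction A₂,
    inner ℝ x (mixedPayoff u p q) ≤ 0

theorem inner_mixedPayoff (u : A₁ → A₂ → EuclideanSpace ℝ (Fin m))
    (x : EuclideanSpace ℝ (Fin m)) (p : MixedAction A₁) (q : MixedAction A₂) :
    inner ℝ x (mixedPayoff u p q) = ∑ a, ∑ b, p a * q b * inner ℝ x (u a b) := by
  simp [mixedPayoff, inner_sum, inner_smul_right]

theorem sum_sum_mul_eq_one (p : MixedAction A₁) (q : MixedAction A₂) :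
    ∑ a, ∑ b, p a * q b = 1 := by
  have hp : ∑ a, p a = 1 := p.2.2
  have hq : ∑ b, q b = 1 := q.2.2
  rw [← Finset.sum_mul_sum, hp, hq, one_mul]

theorem mixedAction_nonneg {A : Type*} [Fintype A] (p : MixedAction A) (a : A) : 0 ≤ p a :=
  p.2.1 a

theorem exists_payoff_bound (u : A₁ → A₂ → EuclideanSpace ℝ (Fin m)) :
    ∃ C : ℝ, 0 < C ∧ ∀ a b, ‖u a b‖ ≤ C := by
  refine ⟨1 + ∑ a, ∑ b, ‖u a b‖, by positivity, fun a b => ?_⟩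
  have h1 := Finset.single_le_sum (f := fun a => ∑ b, ‖u a b‖) (fun _ _ => by positivity)
    (Finset.mem_univ a)
  have h2 := Finset.single_le_sum (f := fun b => ‖u a b‖) (fun _ _ => by positivity)
    (Finset.mem_univ b)
  linarith

theorem norm_mixedPayoff_le {u : A₁ → A₂ → EuclideanSpace ℝ (Fin m)} {C : ℝ}
    (hC : ∀ a b, ‖u a b‖ ≤ C) (p : MixedAction A₁) (q : MixedAction A₂) :
    ‖mixedPayoff u p q‖ ≤ C := by
  have h : ∀ a b, ‖(p a * q b) • u a b‖ ≤ p a * q b * C := fun a b => by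
    have h0 := mul_nonneg (mixedAction_nonneg p a) (mixedAction_nonneg q b)
    rw [norm_smul, Real.norm_of_nonneg h0]
    exact mul_le_mul_of_nonneg_left (hC a b) h0
  calc ‖mixedPayoff u p q‖ ≤ ∑ a, ∑ b, p a * q b * C :=
        (norm_sum_le _ _).trans (Finset.sum_le_sum fun a _ =>
          (norm_sum_le _ _).trans (Finset.sum_le_sum fun b _ => h a b))
    _ = C := by
        simp_rw [← Finset.sum_mul]
        rw [sum_sum_mul_eq_one, one_mul]

/-- If Blackwell's condition fails, then by the minimax theorem Player 2 has a mixed action which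
keeps the payoff in an open half-space that misses the origin. -/
theorem exists_separating_action [Nonempty A₁] {u : A₁ → A₂ → EuclideanSpace ℝ (Fin m)}
    (hu : ¬ BlackwellCondition u) :
    ∃ (x : EuclideanSpace ℝ (Fin m)) (q : MixedAction A₂) (c : ℝ), 0 < c ∧
      ∀ p : MixedAction A₁, c ≤ inner ℝ x (mixedPayoff u p q) := by
  classical
  simp only [BlackwellCondition, not_forall, not_exists, not_le] at hu
  obtain ⟨x, hx⟩ := hu
  -- `L p` lists the payoffs of `p` in direction `x` against the pure actions of Player 2. If all
  -- were nonpositive, `p` would be good against every `q`, so the image of the simplex misses the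
  -- nonpositive orthant.
  let L : (A₁ → ℝ) →ₗ[ℝ] (A₂ → ℝ) :=
    LinearMap.pi fun b => ∑ a, (inner ℝ x (u a b)) • LinearMap.proj a
  have hL : ∀ p b, L p b = ∑ a, p a * inner ℝ x (u a b) := fun p b => by
    simp [L, mul_comm]
  have disj : Disjoint (Set.Iic (0 : A₂ → ℝ)) (L '' stdSimplex ℝ A₁) := by
    rw [Set.disjoint_left]
    rintro _ hy ⟨p, hp, rfl⟩
    obtain ⟨q, hq⟩ := hx ⟨p, hp⟩
    rw [inner_mixedPayoff, Finset.sum_comm] at hq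
    refine hq.not_ge (Finset.sum_nonpos fun b _ => ?_)
    have h2 : ∑ a, p a * q b * inner ℝ x (u a b) = q b * L p b := by
      rw [hL, Finset.mul_sum]
      exact Finset.sum_congr rfl fun a _ => by ring
    exact h2.le.trans (mul_nonpos_of_nonneg_of_nonpos (mixedAction_nonneg q b) (hy b))
  obtain ⟨f, s, t, hs, hst, ht⟩ := geometric_hahn_banach_closed_compact (convex_Iic _) isClosed_Iic
    ((convex_stdSimplex ℝ A₁).linear_image L)
    ((isCompact_stdSimplex ℝ A₁).image L.continuous_of_finiteDimensional) disj
  have hs0 : 0 < s := by simpa using hs 0 (by simp)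
  -- A negative coefficient would put into the nonpositive orthant a multiple of the basis vector on
  -- which `f` equals `s`. Normalizing the coefficients by their sum `W` gives the mixed action of
  -- Player 2.
  have hw : ∀ b, 0 ≤ f (Pi.single b 1) := by
    intro b
    by_contra! h
    have := hs ((s / f (Pi.single b 1)) • Pi.single b 1) (by
      rw [Set.mem_Iic, Pi.le_def]
      intro i
      have h1 : (0 : ℝ) ≤ (Pi.single b 1 : A₂ → ℝ) i := by
        by_cases hi : i = b
        · subst hi; simp
        · simp [hi]
      exact mul_nonpos_of_nonpos_of_nonneg (div_nonpos_of_nonneg_of_nonpos hs0.le h.le) h1)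
    rw [map_smul, smul_eq_mul, div_mul_cancel₀ _ h.ne] at this
    exact lt_irrefl _ this
  have hf : ∀ y : A₂ → ℝ, f y = ∑ b, y b * f (Pi.single b 1) := fun y => by
    conv_lhs => rw [pi_eq_sum_univ' y, map_sum]
    exact Finset.sum_congr rfl fun b _ => by
      rw [map_smul, smul_eq_mul]
  set W := ∑ b, f (Pi.single b 1) with hW
  have hW0 : 0 < W := by
    refine lt_of_le_of_ne (Finset.sum_nonneg fun b _ => hw b) fun h => ?_
    have h0 := (Finset.sum_eq_zero_iff_of_nonneg fun b _ => hw b).1 h.symm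
    obtain ⟨p⟩ : Nonempty (MixedAction A₁) := inferInstance
    have := ht _ ⟨p.1, p.2, rfl⟩
    rw [hf, Finset.sum_eq_zero fun b hb => by rw [h0 b hb, mul_zero]] at this
    linarith
  refine ⟨x, ⟨fun b => f (Pi.single b 1) / W, fun b => div_nonneg (hw b) hW0.le, ?_⟩, t / W,
    div_pos (hs0.trans hst) hW0, fun p => ?_⟩
  · rw [← Finset.sum_div, ← hW, div_self hW0.ne']
  · have := ht _ ⟨p.1, p.2, rfl⟩
    rw [inner_mixedPayoff, Finset.sum_comm, div_le_iff₀ hW0]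
    refine this.le.trans (le_of_eq ?_)
    rw [hf, Finset.sum_mul]
    refine Finset.sum_congr rfl fun b _ => ?_
    rw [hL, Finset.sum_mul, Finset.sum_mul]
    refine Finset.sum_congr rfl fun a _ => ?_
    change p a * inner ℝ x (u a b) * _ = p a * (f (Pi.single b 1) / W) * inner ℝ x (u a b) * W
    field_simp

end Payoff

/-! ### Continuous time -/

section Continuous

variable {A₁ A₂ : Type*} [Fintype A₁] [Fintype A₂] {m : ℕ}

theorem measurable_mixedAction_apply {A : Type*} [Fintype A] (a : A) :
    Measurable fun p : MixedAction A => p a :=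
  (measurable_pi_apply a).comp measurable_subtype_coe

theorem measurable_mixedPayoff_control (u : A₁ → A₂ → EuclideanSpace ℝ (Fin m))
    (a : Control A₁) (b : Control A₂) :
    Measurable fun s : ℝ => mixedPayoff u (a.at s.toNNReal) (b.at s.toNNReal) := by
  refine Finset.measurable_sum _ fun i _ => Finset.measurable_sum _ fun j _ => ?_
  refine Measurable.smul_const (Measurable.mul ?_ ?_) _
  · exact (measurable_mixedAction_apply i).comp (a.2.comp measurable_real_toNNReal)
  · exact (measurable_mixedAction_apply j).comp (b.2.comp measurable_real_toNNReal)

theorem intervalIntegrable_mixedPayoff (u : A₁ → A₂ → EuclideanSpace ℝ (Fin m))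
    (a : Control A₁) (b : Control A₂) (s t : ℝ) :
    IntervalIntegrable (fun r : ℝ => mixedPayoff u (a.at r.toNNReal) (b.at r.toNNReal))
      volume s t := by
  obtain ⟨C, -, hC⟩ := exists_payoff_bound u
  refine (intervalIntegrable_const (c := C)).mono_fun
    (measurable_mixedPayoff_control u a b).aestronglyMeasurable (Eventually.of_forall fun r => ?_)
  exact (norm_mixedPayoff_le hC _ _).trans (le_abs_self C)

/-- The control that always chooses the same mixed action. -/
def Control.const {A : Type*} [Fintype A] (p : MixedAction A) : Control A :=
  ⟨fun _ => p, measurable_const⟩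

/-- The strategy that chooses the same mixed action whatever the opponent does. -/
def DelayStrategy.const {A B : Type*} [Fintype A] [Fintype B] (p : MixedAction A) :
    DelayStrategy A B where
  respond _ := Control.const p
  delay := ⟨fun k => k, by simp, Nat.strictMono_cast, tendsto_natCast_atTop_atTop,
    fun _ _ _ _ _ _ => rfl⟩

/-- Only the payoff at time `T` matters: against the constant `q` its component along `x` is at
least `c * T`, whereas `ε` is chosen with `‖x‖ * ε < c * T`. -/
theorem blackwellCondition_of_attainable [Nonempty A₁] [Nonempty A₂]
    {u : A₁ → A₂ → EuclideanSpace ℝ (Fin m)} (hu : Attainable u 0) : BlackwellCondition u := by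
  by_contra h
  obtain ⟨x, q, c, hc, hq⟩ := exists_separating_action h
  obtain ⟨T, hT, hu⟩ := hu
  obtain ⟨σ, hσ⟩ := hu (c * T / (‖x‖ + 1)) (by positivity)
  have h1 := hσ T le_rfl (DelayStrategy.const q)
  rw [dist_zero_right] at h1
  have h2 : (play σ (DelayStrategy.const q)).2 = Control.const q := (play_isPlay σ _).2
  set a := (play σ (DelayStrategy.const q)).1 with ha
  have h3 : cumulativePayoff u σ (DelayStrategy.const q) T =
      ∫ s in (0 : ℝ)..T, mixedPayoff u (a.at s.toNNReal) ((Control.const q).at s.toNNReal) := by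
    rw [cumulativePayoff, h2]
  have hi := intervalIntegrable_mixedPayoff u a (Control.const q) 0 T
  have h4 : c * T ≤ inner ℝ x (cumulativePayoff u σ (DelayStrategy.const q) T) := by
    rw [h3, ← innerSL_apply_apply ℝ, ← ContinuousLinearMap.intervalIntegral_comp_comm _ hi]
    calc c * T = ∫ _ in (0 : ℝ)..T, c := by simp [mul_comm]
      _ ≤ _ := intervalIntegral.integral_mono_on hT.le intervalIntegrable_const
        ⟨(innerSL ℝ x).integrable_comp hi.1, (innerSL ℝ x).integrable_comp hi.2⟩ fun s _ => hq _
  have h5 := h4.trans (real_inner_le_norm _ _)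
  have h6 := mul_le_mul_of_nonneg_left h1 (norm_nonneg x)
  rw [← mul_div_assoc, mul_div_right_comm] at h6
  have h7 : ‖x‖ / (‖x‖ + 1) < 1 := (div_lt_one (by positivity)).2 (by linarith)
  nlinarith [mul_pos hc hT]

/-- While Player 1 uses a mixed action that keeps the payoff opposite to the cumulative payoff `x`,
the square of the norm grows at most quadratically in the elapsed time. -/
theorem norm_sq_add_integral_le {u : A₁ → A₂ → EuclideanSpace ℝ (Fin m)} {C : ℝ}
    (hC : ∀ a b, ‖u a b‖ ≤ C) {x : EuclideanSpace ℝ (Fin m)} {p : MixedAction A₁}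
    (hp : ∀ q, inner ℝ x (mixedPayoff u p q) ≤ 0) (b : Control A₂) {s t : ℝ} (hst : s ≤ t) :
    ‖x + ∫ r in s..t, mixedPayoff u p (b.at r.toNNReal)‖ ^ 2 ≤
      ‖x‖ ^ 2 + C ^ 2 * (t - s) ^ 2 := by
  have hi : IntervalIntegrable (fun r : ℝ => mixedPayoff u p (b.at r.toNNReal)) volume s t :=
    intervalIntegrable_mixedPayoff u (Control.const p) b s t
  have h1 : inner ℝ x (∫ r in s..t, mixedPayoff u p (b.at r.toNNReal)) ≤ 0 := by
    rw [← innerSL_apply_apply ℝ, ← ContinuousLinearMap.intervalIntegral_comp_comm _ hi]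
    have := intervalIntegral.integral_nonneg
      (μ := volume) (f := fun r : ℝ => - (innerSL ℝ x) (mixedPayoff u p (b.at r.toNNReal))) hst fun r _ =>
        neg_nonneg.2 (hp (b.at r.toNNReal))
    rw [intervalIntegral.integral_neg] at this
    linarith
  have h2 : ‖∫ r in s..t, mixedPayoff u p (b.at r.toNNReal)‖ ≤ C * |t - s| :=
    intervalIntegral.norm_integral_le_of_norm_le_const fun r _ => norm_mixedPayoff_le hC _ _
  have h3 := pow_le_pow_left₀ (norm_nonneg _) h2 2
  rw [mul_pow, sq_abs] at h3
  rw [norm_add_sq_real]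
  linarith

/-- The end of the first `k` blocks, when the block `i` has length `d i`. -/
noncomputable def blockStart (d : ℕ → ℝ≥0) (k : ℕ) : ℝ≥0 := ∑ i ∈ Finset.range k, d i

theorem blockStart_succ (d : ℕ → ℝ≥0) (k : ℕ) :
    blockStart d (k + 1) = blockStart d k + d k :=
  Finset.sum_range_succ _ _

theorem blockStart_strictMono {d : ℕ → ℝ≥0} (hd : ∀ k, 0 < d k) : StrictMono (blockStart d) :=
  strictMono_nat_of_lt_succ fun k => by
    rw [blockStart_succ]
    exact lt_add_of_pos_right _ (hd k)

open Classical in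
/-- The block that contains the time `t` (and `0` if the blocks end before `t`). -/
noncomputable def blockIndex (d : ℕ → ℝ≥0) (t : ℝ≥0) : ℕ :=
  if h : ∃ k, t < blockStart d (k + 1) then Nat.find h else 0

theorem blockIndex_eq {d : ℕ → ℝ≥0} (hd : ∀ k, 0 < d k) {k : ℕ} {t : ℝ≥0}
    (h1 : blockStart d k ≤ t) (h2 : t < blockStart d (k + 1)) : blockIndex d t = k := by
  classical
  have h : ∃ k, t < blockStart d (k + 1) := ⟨k, h2⟩
  rw [blockIndex, dif_pos h, Nat.find_eq_iff]
  exact ⟨h2, fun j hj => not_lt.2 (((blockStart_strictMono hd).monotone hj).trans h1)⟩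

theorem blockIndex_spec {d : ℕ → ℝ≥0} (hdt : Tendsto (blockStart d) atTop atTop) (t : ℝ≥0) :
    blockStart d (blockIndex d t) ≤ t ∧ t < blockStart d (blockIndex d t + 1) := by
  classical
  have h : ∃ k, t < blockStart d (k + 1) :=
    ((tendsto_add_atTop_iff_nat 1).2 hdt |>.eventually_gt_atTop t).exists
  rw [blockIndex, dif_pos h]
  refine ⟨?_, Nat.find_spec h⟩
  rcases hk : Nat.find h with _ | k
  · simp [blockStart]
  · exact not_lt.1 (Nat.find_min h (by omega : k < Nat.find h))

theorem measurable_blockIndex {d : ℕ → ℝ≥0} (hd : ∀ k, 0 < d k)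
    (hdt : Tendsto (blockStart d) atTop atTop) : Measurable (blockIndex d) := by
  refine measurable_to_nat fun t => ?_
  have : blockIndex d ⁻¹' {blockIndex d t} =
      Set.Ico (blockStart d (blockIndex d t)) (blockStart d (blockIndex d t + 1)) := by
    ext s
    refine ⟨fun h => ?_, fun h => blockIndex_eq hd h.1 h.2⟩
    rw [← Set.mem_singleton_iff.1 h]
    exact blockIndex_spec hdt s
  rw [this]
  exact measurableSet_Ico

/-- The cumulative payoff at the start of the block `k` if, in each block, Player 1 uses the mixed
action that `p` assigns to the cumulative payoff at the start of that block. -/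
noncomputable def blockPayoff (u : A₁ → A₂ → EuclideanSpace ℝ (Fin m))
    (p : EuclideanSpace ℝ (Fin m) → MixedAction A₁) (d : ℕ → ℝ≥0) (b : Control A₂) :
    ℕ → EuclideanSpace ℝ (Fin m)
  | 0 => 0
  | k + 1 => blockPayoff u p d b k + ∫ s in (blockStart d k : ℝ)..(blockStart d (k + 1) : ℝ),
      mixedPayoff u (p (blockPayoff u p d b k)) (b.at s.toNNReal)

theorem blockPayoff_congr (u : A₁ → A₂ → EuclideanSpace ℝ (Fin m))
    (p : EuclideanSpace ℝ (Fin m) → MixedAction A₁) {d : ℕ → ℝ≥0} (hd : ∀ k, 0 < d k)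
    {b b' : Control A₂} {k : ℕ} (h : ∀ t < blockStart d k, b.at t = b'.at t) :
    blockPayoff u p d b k = blockPayoff u p d b' k := by
  have hmono := blockStart_strictMono hd
  induction k with
  | zero => rfl
  | succ k ih =>
    rw [blockPayoff, blockPayoff, ih fun t ht => h t (ht.trans (hmono k.lt_succ_self))]
    congr 1
    refine intervalIntegral.integral_congr_Ioo_of_le
      (NNReal.coe_le_coe.2 (hmono k.lt_succ_self).le) fun s hs => ?_
    rw [h _ ((Real.toNNReal_lt_iff_lt_coe ((NNReal.coe_nonneg _).trans hs.1.le)).2 hs.2)]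

/-- The strategy with delay that, in each block, uses the mixed action that `p` assigns to the
cumulative payoff at the start of that block. -/
noncomputable def blockStrategy (u : A₁ → A₂ → EuclideanSpace ℝ (Fin m))
    (p : EuclideanSpace ℝ (Fin m) → MixedAction A₁) {d : ℕ → ℝ≥0} (hd : ∀ k, 0 < d k)
    (hdt : Tendsto (blockStart d) atTop atTop) : DelayStrategy A₁ A₂ where
  respond b := ⟨fun t => p (blockPayoff u p d b (blockIndex d t)),
    (measurable_from_nat (f := fun k => p (blockPayoff u p d b k))).comp
      (measurable_blockIndex hd hdt)⟩
  delay := by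
    have hmono := blockStart_strictMono hd
    refine ⟨blockStart d, by simp [blockStart], hmono, hdt, fun b b' k h t ht => ?_⟩
    -- The action in a block uses only what happened before the block starts, so the block ends
    -- serve as updating times.
    refine congrArg p (blockPayoff_congr u p hd fun s hs => h s (hs.trans_le ?_))
    have := (blockIndex_spec hdt t).1.trans_lt ht
    exact hmono.monotone (Nat.lt_succ_iff.1 (hmono.lt_iff_lt.1 this))

theorem blockStrategy_at (u : A₁ → A₂ → EuclideanSpace ℝ (Fin m))
    (p : EuclideanSpace ℝ (Fin m) → MixedAction A₁) {d : ℕ → ℝ≥0} (hd : ∀ k, 0 < d k)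
    (hdt : Tendsto (blockStart d) atTop atTop) (b : Control A₂) (t : ℝ≥0) :
    ((blockStrategy u p hd hdt).respond b).at t = p (blockPayoff u p d b (blockIndex d t)) :=
  rfl

theorem integral_blockStrategy (u : A₁ → A₂ → EuclideanSpace ℝ (Fin m))
    (p : EuclideanSpace ℝ (Fin m) → MixedAction A₁) {d : ℕ → ℝ≥0} (hd : ∀ k, 0 < d k)
    (hdt : Tendsto (blockStart d) atTop atTop) (b : Control A₂) {k : ℕ} {t : ℝ}
    (h1 : blockStart d k ≤ t) (h2 : t ≤ blockStart d (k + 1)) :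
    ∫ s in (0 : ℝ)..t, mixedPayoff u (((blockStrategy u p hd hdt).respond b).at s.toNNReal)
        (b.at s.toNNReal) =
      blockPayoff u p d b k +
        ∫ s in (blockStart d k : ℝ)..t, mixedPayoff u (p (blockPayoff u p d b k))
          (b.at s.toNNReal) := by
  have hmono := blockStart_strictMono hd
  have seg : ∀ (k : ℕ) (t : ℝ), blockStart d k ≤ t → t ≤ blockStart d (k + 1) →
      ∫ s in (blockStart d k : ℝ)..t, mixedPayoff u
          (((blockStrategy u p hd hdt).respond b).at s.toNNReal) (b.at s.toNNReal) =
        ∫ s in (blockStart d k : ℝ)..t, mixedPayoff u (p (blockPayoff u p d b k))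
          (b.at s.toNNReal) := by
    intro k t h1 h2
    -- The open interval avoids the endpoint `t = blockStart d (k + 1)`, where the block index has
    -- already jumped.
    refine intervalIntegral.integral_congr_Ioo_of_le h1 fun s hs => ?_
    rw [blockStrategy_at, blockIndex_eq hd (NNReal.le_toNNReal_of_coe_le hs.1.le)
      ((Real.toNNReal_lt_iff_lt_coe ((NNReal.coe_nonneg _).trans hs.1.le)).2 (hs.2.trans_le h2))]
  have start : ∀ k, ∫ s in (0 : ℝ)..(blockStart d k : ℝ), mixedPayoff u
      (((blockStrategy u p hd hdt).respond b).at s.toNNReal) (b.at s.toNNReal) =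
        blockPayoff u p d b k := by
    intro k
    induction k with
    | zero => simp [blockStart, blockPayoff]
    | succ k ih =>
      rw [← intervalIntegral.integral_add_adjacent_intervals
        (intervalIntegrable_mixedPayoff u _ b 0 (blockStart d k))
        (intervalIntegrable_mixedPayoff u _ b _ _), ih,
        seg k _ (NNReal.coe_le_coe.2 (hmono k.lt_succ_self).le) le_rfl, blockPayoff]
  rw [← intervalIntegral.integral_add_adjacent_intervals
    (intervalIntegrable_mixedPayoff u _ b 0 (blockStart d k))
    (intervalIntegrable_mixedPayoff u _ b _ _), start, seg k t h1 h2]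

theorem norm_sq_integral_blockStrategy_le {u : A₁ → A₂ → EuclideanSpace ℝ (Fin m)} {C : ℝ}
    (hC : ∀ a b, ‖u a b‖ ≤ C) {p : EuclideanSpace ℝ (Fin m) → MixedAction A₁}
    (hp : ∀ x q, inner ℝ x (mixedPayoff u (p x) q) ≤ 0) {d : ℕ → ℝ≥0} (hd : ∀ k, 0 < d k)
    (hdt : Tendsto (blockStart d) atTop atTop) {D : ℝ}
    (hD : ∀ k, ∑ i ∈ Finset.range k, (d i : ℝ) ^ 2 ≤ D) (b : Control A₂) {t : ℝ} (ht : 0 ≤ t) :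
    ‖∫ s in (0 : ℝ)..t, mixedPayoff u (((blockStrategy u p hd hdt).respond b).at s.toNNReal)
        (b.at s.toNNReal)‖ ^ 2 ≤ C ^ 2 * D := by
  have hmono := blockStart_strictMono hd
  have hk : ∀ k, ‖blockPayoff u p d b k‖ ^ 2 ≤ C ^ 2 * ∑ i ∈ Finset.range k, (d i : ℝ) ^ 2 := by
    intro k
    induction k with
    | zero => simp [blockPayoff]
    | succ k ih =>
      have := norm_sq_add_integral_le hC (hp (blockPayoff u p d b k)) b
        (NNReal.coe_le_coe.2 (hmono k.lt_succ_self).le)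
      rw [blockPayoff, Finset.sum_range_succ]
      have e : (blockStart d (k + 1) : ℝ) - blockStart d k = d k := by
        rw [blockStart_succ]; push_cast; ring
      rw [e] at this
      linarith
  obtain ⟨h1, h2⟩ := blockIndex_spec hdt t.toNNReal
  set k := blockIndex d t.toNNReal
  have h1' : (blockStart d k : ℝ) ≤ t := by
    simpa [Real.coe_toNNReal t ht] using NNReal.coe_le_coe.2 h1
  have h2' : t < blockStart d (k + 1) := by
    simpa [Real.coe_toNNReal t ht] using NNReal.coe_lt_coe.2 h2
  rw [integral_blockStrategy u p hd hdt b h1' h2'.le]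
  refine (norm_sq_add_integral_le hC (hp _) b h1').trans ?_
  have e : (blockStart d (k + 1) : ℝ) = blockStart d k + d k := by
    rw [blockStart_succ]; push_cast; rfl
  have h3 : (t - blockStart d k) ^ 2 ≤ (d k : ℝ) ^ 2 :=
    pow_le_pow_left₀ (by linarith) (by linarith) 2
  -- The unfinished block that contains `t` is charged as a complete one.
  have h4 := hD (k + 1)
  rw [Finset.sum_range_succ] at h4
  nlinarith [hk k, sq_nonneg C, mul_le_mul_of_nonneg_left h3 (sq_nonneg C),
    mul_le_mul_of_nonneg_left h4 (sq_nonneg C)]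

theorem attainable_of_blackwellCondition [Nonempty A₁] [Nonempty A₂]
    {u : A₁ → A₂ → EuclideanSpace ℝ (Fin m)} (hu : BlackwellCondition u) : Attainable u 0 := by
  choose p hp using hu
  obtain ⟨C, hC0, hC⟩ := exists_payoff_bound u
  -- The value of `T` is immaterial: the bound obtained below holds from time 0 on.
  refine ⟨1, one_pos, fun ε hε => ?_⟩
  have hsum : Summable fun i : ℕ => (1 / ((i : ℝ) + 1)) ^ 2 := by
    have := (summable_nat_add_iff 1).2 (Real.summable_one_div_nat_pow.2 one_lt_two)
    simpa using this
  set D := ∑' i : ℕ, (1 / ((i : ℝ) + 1)) ^ 2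
  have hD0 : 0 ≤ D := tsum_nonneg fun i => by positivity
  -- Squared block lengths sum to at most `δ ^ 2 * D`, so the squared norm is at most `C ^ 2 * δ ^ 2
  -- * D`, which is at most `ε ^ 2` because `D ≤ (D + 1) ^ 2`.
  set δ : ℝ := ε / (C * (D + 1)) with hδ
  have hδ0 : 0 < δ := by positivity
  let d : ℕ → ℝ≥0 := fun i => ⟨δ * (1 / ((i : ℝ) + 1)), by positivity⟩
  have hd : ∀ k, 0 < d k := fun k => NNReal.coe_pos.1 (by
    change 0 < δ * (1 / ((k : ℝ) + 1))
    positivity)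
  have hdt : Tendsto (blockStart d) atTop atTop := by
    rw [← NNReal.tendsto_coe_atTop]
    have e : (fun k => (blockStart d k : ℝ)) =
        fun k => δ * ∑ i ∈ Finset.range k, (1 / ((i : ℝ) + 1)) := by
      ext k
      rw [blockStart, NNReal.coe_sum, Finset.mul_sum]
      rfl
    rw [e]
    exact Real.tendsto_sum_range_one_div_nat_succ_atTop.const_mul_atTop hδ0
  have hD : ∀ k, ∑ i ∈ Finset.range k, (d i : ℝ) ^ 2 ≤ δ ^ 2 * D := fun k => by
    have e : ∀ i, (d i : ℝ) ^ 2 = δ ^ 2 * (1 / ((i : ℝ) + 1)) ^ 2 := fun i => mul_pow _ _ _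
    simp_rw [e, ← Finset.mul_sum]
    exact mul_le_mul_of_nonneg_left (hsum.sum_le_tsum _ fun i _ => by positivity) (sq_nonneg _)
  refine ⟨blockStrategy u p hd hdt, fun t ht σ => ?_⟩
  have h1 := norm_sq_integral_blockStrategy_le hC hp hd hdt hD
    (play (blockStrategy u p hd hdt) σ).2 (zero_le_one.trans ht)
  rw [← (play_isPlay (blockStrategy u p hd hdt) σ).1] at h1
  rw [dist_zero_right, cumulativePayoff]
  refine le_of_sq_le_sq (h1.trans ?_) hε.le
  have h2 : C * (D + 1) * δ = ε := by rw [hδ]; field_simp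
  rw [← h2]
  have : D ≤ (D + 1) ^ 2 := by nlinarith
  calc C ^ 2 * (δ ^ 2 * D) ≤ C ^ 2 * (δ ^ 2 * (D + 1) ^ 2) := by gcongr
    _ = _ := by ring

end Continuous

/-! ### Functions of finite histories -/

section History

/-- The action pairs of the first `n` stages. -/
def history {A₁ A₂ : Type*} (n : ℕ) (w : ℕ → A₁ × A₂) : Fin n → A₁ × A₂ := fun i => w i

/-- With finite action sets there are finitely many histories of length `n`, so this factorization
makes measurability and integrability automatic. -/
theorem exists_eq_comp_history {A₁ A₂ : Type*} [Nonempty A₁] [Nonempty A₂] {α : Type*} {n : ℕ}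
    {Φ : (ℕ → A₁ × A₂) → α} (hΦ : DependsOn Φ (Set.Iio n)) :
    ∃ F : (Fin n → A₁ × A₂) → α, Φ = F ∘ history n := by
  obtain ⟨y⟩ : Nonempty (A₁ × A₂) := inferInstance
  refine ⟨fun h => Φ fun i => if hi : i < n then h ⟨i, hi⟩ else y, funext fun w => hΦ fun i hi => ?_⟩
  rw [Set.mem_Iio] at hi
  simp [history, hi]

theorem measurable_history {A₁ A₂ : Type*} [MeasurableSpace A₁] [MeasurableSpace A₂] (n : ℕ) : Measurable (history (A₁ := A₁) (A₂ := A₂) n) :=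
  measurable_pi_lambda _ fun _ => measurable_pi_apply _

end History

/-! ### Conditional means under the law of the discrete play -/

section Discrete

variable {A₁ A₂ : Type*} [Fintype A₁] [Fintype A₂]
  [MeasurableSpace A₁] [DiscreteMeasurableSpace A₁]
  [MeasurableSpace A₂] [DiscreteMeasurableSpace A₂]

theorem integral_mixedMeasure {A : Type*} [Fintype A] [MeasurableSpace A]
    [DiscreteMeasurableSpace A] (p : MixedAction A) (φ : A → ℝ) :
    ∫ a, φ a ∂mixedMeasure p = ∑ a, p a * φ a := by
  rw [mixedMeasure, integral_finsetSum_measure fun a _ =>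
    (Integrable.of_finite (μ := Measure.dirac a)).smul_measure ENNReal.ofReal_ne_top]
  refine Finset.sum_congr rfl fun a _ => ?_
  rw [integral_smul_measure, integral_dirac, ENNReal.toReal_ofReal (mixedAction_nonneg p a),
    smul_eq_mul]

theorem integral_stageMeasure (f : DiscreteStrategy A₁ A₂ A₁) (g : DiscreteStrategy A₁ A₂ A₂)
    (n : ℕ) (h : Fin n → A₁ × A₂) (φ : A₁ × A₂ → ℝ) :
    ∫ y, φ y ∂stageMeasure f g n h = ∑ a, ∑ b, f n h a * g n h b * φ (a, b) := by
  rw [stageMeasure, integral_prod _ Integrable.of_finite, integral_mixedMeasure]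
  refine Finset.sum_congr rfl fun a _ => ?_
  rw [integral_mixedMeasure, Finset.mul_sum]
  exact Finset.sum_congr rfl fun b _ => by ring

instance (f : DiscreteStrategy A₁ A₂ A₁) (g : DiscreteStrategy A₁ A₂ A₂) :
    IsProbabilityMeasure (playLaw f g) := by
  unfold playLaw; infer_instance

theorem measurable_of_dependsOn [Nonempty A₁] [Nonempty A₂] {α : Type*} [MeasurableSpace α] {n : ℕ}
    {Φ : (ℕ → A₁ × A₂) → α} (hΦ : DependsOn Φ (Set.Iio n)) : Measurable Φ := by
  obtain ⟨F, rfl⟩ := exists_eq_comp_history hΦ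
  exact (measurable_of_countable F).comp (measurable_history n)

theorem integrable_of_dependsOn [Nonempty A₁] [Nonempty A₂] {n : ℕ} {Φ : (ℕ → A₁ × A₂) → ℝ}
    (hΦ : DependsOn Φ (Set.Iio n)) (f : DiscreteStrategy A₁ A₂ A₁) (g : DiscreteStrategy A₁ A₂ A₂) :
    Integrable Φ (playLaw f g) := by
  obtain ⟨F, rfl⟩ := exists_eq_comp_history hΦ
  exact (Integrable.of_finite (μ := (playLaw f g).map (history n))).comp_measurable
    (measurable_history n)

/-- Given the first `n + 1` action pairs, the next one is distributed according to
`stageMeasure`. -/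
theorem integral_playLaw_step (f : DiscreteStrategy A₁ A₂ A₁) (g : DiscreteStrategy A₁ A₂ A₂)
    (n : ℕ) (F : (Fin (n + 1) → A₁ × A₂) → A₁ × A₂ → ℝ) :
    ∫ w, F (history (n + 1) w) (w (n + 1)) ∂playLaw f g =
      ∫ w, ∫ y, F (history (n + 1) w) y ∂stageMeasure f g (n + 1) (history (n + 1) w)
        ∂playLaw f g := by
  let e : (Π _ : Finset.Iic n, A₁ × A₂) → Fin (n + 1) → A₁ × A₂ := fun h i =>
    h ⟨i, Finset.mem_Iic.2 (Nat.le_of_lt_succ i.2)⟩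
  have key := Kernel.map_frestrictLe_trajMeasure_compProd_eq_map_trajMeasure
    (X := fun _ => A₁ × A₂) (μ₀ := stageMeasure f g 0 Fin.elim0) (κ := stageKernel f g) (a := n)
  change (playLaw f g).map _ ⊗ₘ _ = (playLaw f g).map _ at key
  have h1 : ∫ w, F (history (n + 1) w) (w (n + 1)) ∂playLaw f g =
      ∫ z, F (e z.1) z.2 ∂((playLaw f g).map
        fun w => (Preorder.frestrictLe (π := fun _ => A₁ × A₂) n w, w (n + 1))) := by
    rw [integral_map (by fun_prop) (measurable_of_countable _).aestronglyMeasurable]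
    rfl
  rw [h1, ← key, Measure.integral_compProd Integrable.of_finite,
    integral_map (by fun_prop) (measurable_of_countable _).aestronglyMeasurable]
  rfl

/-- To compare the means of two functions of the play, it is enough to compare the conditional
mean of the first one, given the past, with the second one. -/
theorem integral_playLaw_mono [Nonempty A₁] [Nonempty A₂] (f : DiscreteStrategy A₁ A₂ A₁)
    (g : DiscreteStrategy A₁ A₂ A₂) {n : ℕ} {Φ Γ : (ℕ → A₁ × A₂) → ℝ}
    (hΦ : DependsOn Φ (Set.Iio (n + 2))) (hΓ : DependsOn Γ (Set.Iio (n + 1)))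
    (h : ∀ w, ∑ a, ∑ b, f (n + 1) (history (n + 1) w) a * g (n + 1) (history (n + 1) w) b *
      Φ (Function.update w (n + 1) (a, b)) ≤ Γ w) :
    ∫ w, Φ w ∂playLaw f g ≤ ∫ w, Γ w ∂playLaw f g := by
  -- Stages after `n + 1` are also filled with `y`; `Φ` does not see them.
  let F : (Fin (n + 1) → A₁ × A₂) → A₁ × A₂ → ℝ := fun h y =>
    Φ fun i => if hi : i < n + 1 then h ⟨i, hi⟩ else y
  have hF : ∀ w y, F (history (n + 1) w) y = Φ (Function.update w (n + 1) y) := fun w y =>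
    hΦ fun i hi => by
      rw [Set.mem_Iio] at hi
      rcases Nat.lt_succ_iff_lt_or_eq.1 hi with hi | rfl
      · simp [history, hi, hi.ne]
      · simp
  have h1 : ∀ w, Φ w = F (history (n + 1) w) (w (n + 1)) := fun w => by
    rw [hF, Function.update_eq_self]
  simp_rw [h1]
  rw [integral_playLaw_step]
  refine integral_mono ?_ (integrable_of_dependsOn hΓ f g) fun w => ?_
  · refine integrable_of_dependsOn (n := n + 1) (fun w w' hw => ?_) f g
    have : history (n + 1) w = history (n + 1) w' := funext fun i => hw _ i.2
    rw [this]
  · rw [integral_stageMeasure]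
    simp_rw [hF]
    exact h w



end Discrete

/-! ### Stage sums and the stopped potential -/

section StageSums

/-- The cumulative payoff over the first `n` stages. -/
noncomputable def stagePayoffSum {A₁ A₂ : Type*} {m : ℕ} (u : A₁ → A₂ → EuclideanSpace ℝ (Fin m))
    (n : ℕ) (w : ℕ → A₁ × A₂) : EuclideanSpace ℝ (Fin m) :=
  ∑ i ∈ Finset.range n, u (w i).1 (w i).2

theorem dependsOn_stagePayoffSum {A₁ A₂ : Type*} {m : ℕ} (u : A₁ → A₂ → EuclideanSpace ℝ (Fin m))
    {n k : ℕ} (hnk : n ≤ k) : DependsOn (stagePayoffSum u n) (Set.Iio k) := fun w w' h =>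
  Finset.sum_congr rfl fun _ hi => by
    rw [h _ (Set.mem_Iio.2 ((Finset.mem_range.1 hi).trans_le hnk))]

theorem stagePayoffSum_update_self {A₁ A₂ : Type*} {m : ℕ}
    (u : A₁ → A₂ → EuclideanSpace ℝ (Fin m)) {n k : ℕ} (hkn : k ≤ n) (w : ℕ → A₁ × A₂)
    (y : A₁ × A₂) : stagePayoffSum u k (Function.update w n y) = stagePayoffSum u k w :=
  dependsOn_stagePayoffSum u le_rfl fun _ hi =>
    Function.update_of_ne ((Set.mem_Iio.1 hi).trans_le hkn).ne _ _

theorem stagePayoffSum_succ_update {A₁ A₂ : Type*} {m : ℕ}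
    (u : A₁ → A₂ → EuclideanSpace ℝ (Fin m)) (n : ℕ) (w : ℕ → A₁ × A₂) (y : A₁ × A₂) :
    stagePayoffSum u (n + 1) (Function.update w n y) = stagePayoffSum u n w + u y.1 y.2 := by
  rw [stagePayoffSum, Finset.sum_range_succ, ← stagePayoffSum, stagePayoffSum_update_self u le_rfl,
    Function.update_self]

theorem averagePayoff_eq {A₁ A₂ : Type*} {m : ℕ} (u : A₁ → A₂ → EuclideanSpace ℝ (Fin m))
    (n : ℕ) (w : ℕ → A₁ × A₂) : averagePayoff u n w = (n : ℝ)⁻¹ • stagePayoffSum u n w :=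
  rfl

theorem norm_averagePayoff_sq {A₁ A₂ : Type*} {m : ℕ} (u : A₁ → A₂ → EuclideanSpace ℝ (Fin m))
    (n : ℕ) (w : ℕ → A₁ × A₂) :
    ‖averagePayoff u n w‖ ^ 2 = ‖stagePayoffSum u n w‖ ^ 2 / (n : ℝ) ^ 2 := by
  rw [averagePayoff_eq, norm_smul, mul_pow, norm_inv, Real.norm_natCast, inv_pow]
  ring

theorem norm_stagePayoffSum_le {A₁ A₂ : Type*} {m : ℕ} {u : A₁ → A₂ → EuclideanSpace ℝ (Fin m)}
    {C : ℝ} (hC : ∀ a b, ‖u a b‖ ≤ C) (n : ℕ) (w : ℕ → A₁ × A₂) :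
    ‖stagePayoffSum u n w‖ ≤ n * C := by
  rw [stagePayoffSum]
  simpa using norm_sum_le_of_le (Finset.range n) fun i _ => hC (w i).1 (w i).2

theorem dependsOn_exceedance {A₁ A₂ : Type*} {m : ℕ} (u : A₁ → A₂ → EuclideanSpace ℝ (Fin m)) (ε : ℝ) (N n : ℕ) :
    DependsOn (fun w => ∃ k, N ≤ k ∧ k < n ∧ ε ≤ ‖averagePayoff u k w‖) (Set.Iio n) := by
  intro w w' h
  refine propext (exists_congr fun k => and_congr_right fun _ => and_congr_right fun hk => ?_)
  rw [averagePayoff_eq, averagePayoff_eq, dependsOn_stagePayoffSum u hk.le h]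

/-- A function of the play that dominates the squared norm of the average payoff and whose
conditional means decrease under Blackwell's strategy. -/
noncomputable def potential {A₁ A₂ : Type*} {m : ℕ} (u : A₁ → A₂ → EuclideanSpace ℝ (Fin m)) (C : ℝ) (n : ℕ)
    (w : ℕ → A₁ × A₂) : ℝ :=
  ‖stagePayoffSum u n w‖ ^ 2 / (n : ℝ) ^ 2 + C ^ 2 / n

open Classical in
/-- The potential, frozen at the value `ε ^ 2` as soon as the norm of the average payoff has reached
`ε` at some stage from `N` on. -/
noncomputable def stoppedPotential {A₁ A₂ : Type*} {m : ℕ}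
    (u : A₁ → A₂ → EuclideanSpace ℝ (Fin m)) (C ε : ℝ) (N n : ℕ)
    (w : ℕ → A₁ × A₂) : ℝ :=
  if ∃ k, N ≤ k ∧ k < n ∧ ε ≤ ‖averagePayoff u k w‖ then ε ^ 2 else potential u C n w

theorem dependsOn_stoppedPotential {A₁ A₂ : Type*} {m : ℕ}
    (u : A₁ → A₂ → EuclideanSpace ℝ (Fin m)) (C ε : ℝ) (N n : ℕ) :
    DependsOn (stoppedPotential u C ε N n) (Set.Iio n) := by
  intro w w' h
  have h1 : (∃ k, N ≤ k ∧ k < n ∧ ε ≤ ‖averagePayoff u k w‖) =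
      ∃ k, N ≤ k ∧ k < n ∧ ε ≤ ‖averagePayoff u k w'‖ := dependsOn_exceedance u ε N n h
  rw [stoppedPotential, stoppedPotential, potential, potential, dependsOn_stagePayoffSum u le_rfl h]
  by_cases h2 : ∃ k, N ≤ k ∧ k < n ∧ ε ≤ ‖averagePayoff u k w‖
  · rw [if_pos h2, if_pos (h1 ▸ h2)]
  · rw [if_neg h2, if_neg (h1 ▸ h2)]

end StageSums

/-! ### Blackwell's strategy and approachability -/

section Approachability

variable {A₁ A₂ : Type*} [Fintype A₁] {m : ℕ}

/-- Discrete counterpart of `norm_sq_add_integral_le`: the cross term of the expanded square is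
nonpositive only after averaging over the action pair. -/
theorem sum_norm_sq_add_le [Fintype A₂] {u : A₁ → A₂ → EuclideanSpace ℝ (Fin m)} {C : ℝ}
    (hC : ∀ a b, ‖u a b‖ ≤ C) {x : EuclideanSpace ℝ (Fin m)} {p : MixedAction A₁}
    {q : MixedAction A₂} (h : inner ℝ x (mixedPayoff u p q) ≤ 0) :
    ∑ a, ∑ b, p a * q b * ‖x + u a b‖ ^ 2 ≤ ‖x‖ ^ 2 + C ^ 2 := by
  have h1 : ∀ a b, p a * q b * ‖x + u a b‖ ^ 2 ≤
      p a * q b * (‖x‖ ^ 2 + C ^ 2) + p a * q b * inner ℝ x (u a b) * 2 := fun a b => by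
    have h0 := mul_nonneg (mixedAction_nonneg p a) (mixedAction_nonneg q b)
    have h2 := mul_le_mul_of_nonneg_left (pow_le_pow_left₀ (norm_nonneg _) (hC a b) 2) h0
    rw [norm_add_sq_real]
    linarith
  refine (Finset.sum_le_sum fun a _ => Finset.sum_le_sum fun b _ => h1 a b).trans ?_
  simp_rw [Finset.sum_add_distrib, ← Finset.sum_mul]
  rw [inner_mixedPayoff] at h
  rw [sum_sum_mul_eq_one]
  linarith

/-- Blackwell's strategy: after each history, the mixed action that `p` assigns to the cumulative
payoff. -/
noncomputable def blackwellStrategy (u : A₁ → A₂ → EuclideanSpace ℝ (Fin m))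
    (p : EuclideanSpace ℝ (Fin m) → MixedAction A₁) : DiscreteStrategy A₁ A₂ A₁ :=
  fun _ h => p (∑ i, u (h i).1 (h i).2)

theorem blackwellStrategy_history (u : A₁ → A₂ → EuclideanSpace ℝ (Fin m))
    (p : EuclideanSpace ℝ (Fin m) → MixedAction A₁) (n : ℕ) (w : ℕ → A₁ × A₂) :
    blackwellStrategy u p n (history n w) = p (stagePayoffSum u n w) :=
  congrArg p (Fin.sum_univ_eq_sum_range (fun i => u (w i).1 (w i).2) n)

variable [Fintype A₂] [Nonempty A₁] [Nonempty A₂]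
  [MeasurableSpace A₁] [DiscreteMeasurableSpace A₁]
  [MeasurableSpace A₂] [DiscreteMeasurableSpace A₂]

theorem integral_norm_stagePayoffSum_sq_le {u : A₁ → A₂ → EuclideanSpace ℝ (Fin m)} {C : ℝ}
    (hC : ∀ a b, ‖u a b‖ ≤ C) {p : EuclideanSpace ℝ (Fin m) → MixedAction A₁}
    (hp : ∀ x q, inner ℝ x (mixedPayoff u (p x) q) ≤ 0) (g : DiscreteStrategy A₁ A₂ A₂) (n : ℕ) :
    ∫ w, ‖stagePayoffSum u (n + 1) w‖ ^ 2 ∂playLaw (blackwellStrategy u p) g ≤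
      (n + 1) * C ^ 2 := by
  have hdep : ∀ n, DependsOn (fun w => ‖stagePayoffSum u n w‖ ^ 2) (Set.Iio n) := fun n w w' h => by
    simp only [dependsOn_stagePayoffSum u le_rfl h]
  induction n with
  | zero =>
    -- `integral_playLaw_mono` covers only stages with a nonempty past, so the first stage is
    -- bounded pointwise.
    calc _ ≤ ∫ _, C ^ 2 ∂playLaw (blackwellStrategy u p) g := by
          refine integral_mono (integrable_of_dependsOn (hdep 1) _ _) (integrable_const _) fun w => ?_
          exact pow_le_pow_left₀ (norm_nonneg _)
            (by simpa using norm_stagePayoffSum_le hC 1 w) 2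
      _ = _ := by simp
  | succ n ih =>
    have h1 : ∫ w, ‖stagePayoffSum u (n + 1 + 1) w‖ ^ 2 ∂playLaw (blackwellStrategy u p) g ≤
        ∫ w, (‖stagePayoffSum u (n + 1) w‖ ^ 2 + C ^ 2) ∂playLaw (blackwellStrategy u p) g := by
      refine integral_playLaw_mono _ _ (hdep (n + 2)) (fun w w' h => ?_) fun w => ?_
      · simp only [dependsOn_stagePayoffSum u le_rfl h]
      · simp_rw [stagePayoffSum_succ_update, blackwellStrategy_history]
        exact sum_norm_sq_add_le hC (hp _ _)
    rw [integral_add (integrable_of_dependsOn (hdep _) _ _) (integrable_const _)] at h1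
    simp only [integral_const, probReal_univ, one_smul] at h1
    push_cast
    linarith

/-- The stopped potential is a supermartingale: freezing can only lower it, and before freezing the
drop of `C ^ 2 / n` pays for the mean increase of the squared norm. -/
theorem integral_stoppedPotential_succ_le {u : A₁ → A₂ → EuclideanSpace ℝ (Fin m)} {C : ℝ}
    (hC : ∀ a b, ‖u a b‖ ≤ C) {p : EuclideanSpace ℝ (Fin m) → MixedAction A₁}
    (hp : ∀ x q, inner ℝ x (mixedPayoff u (p x) q) ≤ 0) (g : DiscreteStrategy A₁ A₂ A₂)
    {ε : ℝ} (hε : 0 ≤ ε) (N n : ℕ) :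
    ∫ w, stoppedPotential u C ε N (n + 2) w ∂playLaw (blackwellStrategy u p) g ≤
      ∫ w, stoppedPotential u C ε N (n + 1) w ∂playLaw (blackwellStrategy u p) g := by
  refine integral_playLaw_mono _ _ (dependsOn_stoppedPotential u C ε N _)
    (dependsOn_stoppedPotential u C ε N _) fun w => ?_
  have havg : ∀ y, ∀ k < n + 2, averagePayoff u k (Function.update w (n + 1) y) =
      averagePayoff u k w := fun y k hk => by
    rw [averagePayoff_eq, averagePayoff_eq, stagePayoffSum_update_self u (by omega)]
  have hev : ∀ y, (∃ k, N ≤ k ∧ k < n + 2 ∧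
      ε ≤ ‖averagePayoff u k (Function.update w (n + 1) y)‖) ↔
      ∃ k, N ≤ k ∧ k < n + 2 ∧ ε ≤ ‖averagePayoff u k w‖ := fun y =>
    exists_congr fun k => and_congr_right fun _ => and_congr_right fun hk => by rw [havg y k hk]
  by_cases hit : ∃ k, N ≤ k ∧ k < n + 2 ∧ ε ≤ ‖averagePayoff u k w‖
  · have h1 : ∀ y, stoppedPotential u C ε N (n + 2) (Function.update w (n + 1) y) = ε ^ 2 :=
      fun y => if_pos ((hev y).2 hit)
    simp_rw [h1, ← Finset.sum_mul, sum_sum_mul_eq_one, one_mul]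
    rw [stoppedPotential]
    split_ifs with hit'
    · exact le_rfl
    · obtain ⟨k, hNk, hk, hεk⟩ := hit
      -- The only new exceedance is at stage `n + 1`, where the potential is already at least the
      -- value `ε ^ 2` at which it is frozen.
      obtain rfl : k = n + 1 := by
        by_contra hne
        exact hit' ⟨k, hNk, by omega, hεk⟩
      rw [potential, ← norm_averagePayoff_sq]
      exact (pow_le_pow_left₀ hε hεk 2).trans (le_add_of_nonneg_right (by positivity))
  · have h1 : ∀ y, stoppedPotential u C ε N (n + 2) (Function.update w (n + 1) y) =
        potential u C (n + 2) (Function.update w (n + 1) y) :=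
      fun y => if_neg (mt (hev y).1 hit)
    have h2 : stoppedPotential u C ε N (n + 1) w = potential u C (n + 1) w :=
      if_neg fun ⟨k, hNk, hk, hεk⟩ => hit ⟨k, hNk, by omega, hεk⟩
    simp_rw [h1, h2, potential, stagePayoffSum_succ_update, blackwellStrategy_history, mul_add,
      Finset.sum_add_distrib, ← Finset.sum_mul, sum_sum_mul_eq_one, ← mul_div_assoc,
      ← Finset.sum_div, one_mul]
    have h3 := sum_norm_sq_add_le hC
      (hp (stagePayoffSum u (n + 1) w) (g (n + 1) (history (n + 1) w)))
    set S := ‖stagePayoffSum u (n + 1) w‖ ^ 2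
    have hS : 0 ≤ S := sq_nonneg _
    refine (add_le_add_left (div_le_div_of_nonneg_right h3 (sq_nonneg _)) _).trans ?_
    push_cast
    have e1 : S / ((n : ℝ) + 2) ^ 2 ≤ S / ((n : ℝ) + 1) ^ 2 := by gcongr; norm_num
    -- This amounts to `(n + 1) * (n + 3) ≤ (n + 2) ^ 2`.
    have e2 : C ^ 2 / ((n : ℝ) + 2) ^ 2 + C ^ 2 / ((n : ℝ) + 2) ≤ C ^ 2 / ((n : ℝ) + 1) := by
      rw [div_add_div _ _ (by positivity) (by positivity),
        div_le_div_iff₀ (by positivity) (by positivity)]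
      have : 0 ≤ C ^ 2 * ((n : ℝ) + 2) := by positivity
      nlinarith
    rw [add_div]
    linarith

/-- Maximal inequality: the stopped potential equals `ε ^ 2` on the event, is nonnegative elsewhere,
and its mean never exceeds its initial mean. That mean is at most `2 * C ^ 2 / (N + 1)`, half from
the second moment and half from the correction term. -/
theorem measureReal_exceedance_le {u : A₁ → A₂ → EuclideanSpace ℝ (Fin m)} {C : ℝ}
    (hC : ∀ a b, ‖u a b‖ ≤ C) {p : EuclideanSpace ℝ (Fin m) → MixedAction A₁}
    (hp : ∀ x q, inner ℝ x (mixedPayoff u (p x) q) ≤ 0) (g : DiscreteStrategy A₁ A₂ A₂)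
    {ε : ℝ} (hε : 0 ≤ ε) (N n : ℕ) :
    (playLaw (blackwellStrategy u p) g).real
        {w | ∃ k, N + 1 ≤ k ∧ k < n ∧ ε ≤ ‖averagePayoff u k w‖} * ε ^ 2 ≤
      2 * C ^ 2 / (N + 1) := by
  set P := playLaw (blackwellStrategy u p) g
  have h0 : ∫ w, stoppedPotential u C ε (N + 1) (N + 1) w ∂P ≤ 2 * C ^ 2 / (N + 1) := by
    have h1 : ∀ w, stoppedPotential u C ε (N + 1) (N + 1) w = potential u C (N + 1) w := fun w =>
      if_neg fun ⟨k, h1, h2, _⟩ => by omega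
    have hi : Integrable (fun w => ‖stagePayoffSum u (N + 1) w‖ ^ 2) P :=
      integrable_of_dependsOn (n := N + 1)
        (fun w w' h => by simp only [dependsOn_stagePayoffSum u le_rfl h]) _ _
    simp_rw [h1, potential]
    rw [integral_add (hi.div_const _) (integrable_const _), integral_div]
    have h2 := integral_norm_stagePayoffSum_sq_le hC hp g N
    simp only [integral_const, probReal_univ, one_smul]
    push_cast
    have h3 := div_le_div_of_nonneg_right h2 (sq_nonneg ((N : ℝ) + 1))
    have e : ((N : ℝ) + 1) * C ^ 2 / ((N : ℝ) + 1) ^ 2 = C ^ 2 / (N + 1) := by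
      field_simp
    rw [e] at h3
    have e' : 2 * C ^ 2 / ((N : ℝ) + 1) = C ^ 2 / (N + 1) + C ^ 2 / (N + 1) := by ring
    rw [e']
    linarith
  have hmono : ∀ j, ∫ w, stoppedPotential u C ε (N + 1) (N + j + 1) w ∂P ≤
      2 * C ^ 2 / (N + 1) := by
    intro j
    induction j with
    | zero => exact h0
    | succ j ih => exact (integral_stoppedPotential_succ_le hC hp g hε _ _).trans ih
  have hmeas : MeasurableSet
      {w | ∃ k, N + 1 ≤ k ∧ k < N + n + 1 ∧ ε ≤ ‖averagePayoff u k w‖} :=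
    measurableSet_setOfPred.2 (measurable_of_dependsOn (dependsOn_exceedance u ε (N + 1) (N + n + 1)))
  calc _ ≤ P.real {w | ∃ k, N + 1 ≤ k ∧ k < N + n + 1 ∧ ε ≤ ‖averagePayoff u k w‖} * ε ^ 2 := by
        refine mul_le_mul_of_nonneg_right (measureReal_mono ?_) (sq_nonneg _)
        exact fun w ⟨k, h1, h2, h3⟩ => ⟨k, h1, by omega, h3⟩
    _ = ∫ w, Set.indicator {w | ∃ k, N + 1 ≤ k ∧ k < N + n + 1 ∧ ε ≤ ‖averagePayoff u k w‖}
          (fun _ => ε ^ 2) w ∂P := by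
        rw [integral_indicator_const _ hmeas, smul_eq_mul]
    _ ≤ ∫ w, stoppedPotential u C ε (N + 1) (N + n + 1) w ∂P := by
        refine integral_mono ((integrable_const _).indicator hmeas)
          (integrable_of_dependsOn (dependsOn_stoppedPotential u C ε _ _) _ _) fun w => ?_
        rw [stoppedPotential]
        split_ifs with hit
        · exact Set.indicator_le_self' (fun _ _ => sq_nonneg ε) w
        · have hw : w ∉ {w | ∃ k, N + 1 ≤ k ∧ k < N + n + 1 ∧ ε ≤ ‖averagePayoff u k w‖} := hit
          rw [Set.indicator_of_notMem hw, potential]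
          positivity
    _ ≤ _ := hmono n

theorem approachable_of_blackwellCondition {u : A₁ → A₂ → EuclideanSpace ℝ (Fin m)}
    (hu : BlackwellCondition u) : Approachable u 0 := by
  choose p hp using hu
  obtain ⟨C, hC0, hC⟩ := exists_payoff_bound u
  refine ⟨blackwellStrategy u p, fun ε hε => ?_⟩
  -- The target is `ε / 2` because the passage to the union over horizons preserves only weak
  -- inequalities.
  obtain ⟨N, hN⟩ := exists_nat_gt (2 * C ^ 2 / (ε ^ 2 * (ε / 2)))
  refine ⟨N + 1, fun g => ?_⟩
  set P := playLaw (blackwellStrategy u p) g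
  have hunion : {w | ∃ n, N + 1 ≤ n ∧ ε ≤ dist (averagePayoff u n w) 0} =
      ⋃ n, {w | ∃ k, N + 1 ≤ k ∧ k < n ∧ ε ≤ ‖averagePayoff u k w‖} := by
    ext w
    simp only [dist_zero_right, Set.mem_ofPred_eq, Set.mem_iUnion]
    exact ⟨fun ⟨k, h1, h2⟩ => ⟨k + 1, k, h1, k.lt_succ_self, h2⟩, fun ⟨_, k, h1, _, h2⟩ => ⟨k, h1, h2⟩⟩
  have hm : Monotone fun n => {w : ℕ → A₁ × A₂ |
      ∃ k, N + 1 ≤ k ∧ k < n ∧ ε ≤ ‖averagePayoff u k w‖} :=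
    fun _ _ hij _ ⟨k, h1, h2, h3⟩ => ⟨k, h1, h2.trans_le hij, h3⟩
  rw [hunion, hm.measure_iUnion]
  refine lt_of_le_of_lt (b := ENNReal.ofReal (ε / 2)) (iSup_le fun n => ?_)
    ((ENNReal.ofReal_lt_ofReal_iff hε).2 (half_lt_self hε))
  rw [← ofReal_measureReal]
  refine ENNReal.ofReal_le_ofReal ?_
  have h1 := measureReal_exceedance_le hC hp g hε.le N n
  rw [div_lt_iff₀ (by positivity)] at hN
  have h2 : 2 * C ^ 2 / ((N : ℝ) + 1) ≤ ε ^ 2 * (ε / 2) := by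
    rw [div_le_iff₀ (by positivity)]
    have : 0 ≤ ε ^ 2 * (ε / 2) := by positivity
    linarith
  have h3 := h1.trans h2
  rw [mul_comm] at h3
  exact le_of_mul_le_mul_left h3 (by positivity)

/-- Against the constant `q`, the mean of `⟪x, S_n⟫` grows by at least `c` per stage after the
first. Approachability caps its growth at rate `c / 2`: the average is below `ε` in norm outside an
event of probability at most `ε`, and bounded by `C` on it. -/
theorem blackwellCondition_of_approachable {u : A₁ → A₂ → EuclideanSpace ℝ (Fin m)}
    (hu : Approachable u 0) : BlackwellCondition u := by
  by_contra h
  obtain ⟨x, q, c, hc, hq⟩ := exists_separating_action h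
  obtain ⟨C, hC0, hC⟩ := exists_payoff_bound u
  obtain ⟨f, hf⟩ := hu
  set ε := c / (2 * (‖x‖ * (1 + C) + 1)) with hεdef
  have hε : 0 < ε := by positivity
  obtain ⟨N, hN⟩ := hf ε hε
  let g : DiscreteStrategy A₁ A₂ A₂ := fun _ _ => q
  have hg := hN g
  set P := playLaw f g
  have hdep : ∀ n, DependsOn (fun w => inner ℝ x (stagePayoffSum u n w)) (Set.Iio n) :=
    fun n w w' h => by simp only [dependsOn_stagePayoffSum u le_rfl h]
  have hint : ∀ n, Integrable (fun w => inner ℝ x (stagePayoffSum u n w)) P := fun n =>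
    integrable_of_dependsOn (hdep n) f g
  have hinner : ∀ n w, |inner ℝ x (stagePayoffSum u n w)| ≤ ‖x‖ * (n * C) := fun n w =>
    (abs_real_inner_le_norm _ _).trans
      (mul_le_mul_of_nonneg_left (norm_stagePayoffSum_le hC n w) (norm_nonneg x))
  have hlow : ∀ n : ℕ, n * c - ‖x‖ * C ≤ ∫ w, inner ℝ x (stagePayoffSum u (n + 1) w) ∂P := by
    intro n
    induction n with
    | zero =>
      calc _ = ∫ _, -(‖x‖ * C) ∂P := by simp
        _ ≤ _ := integral_mono (integrable_const _) (hint _) fun w => by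
          have := (abs_le.1 (hinner 1 w)).1
          simpa using this
    | succ n ih =>
      -- The sign is reversed because `integral_playLaw_mono` gives upper bounds.
      have h1 : ∫ w, -inner ℝ x (stagePayoffSum u (n + 2) w) ∂P ≤
          ∫ w, -(inner ℝ x (stagePayoffSum u (n + 1) w) + c) ∂P := by
        refine integral_playLaw_mono f g (n := n)
          (fun w w' h => by simp only [dependsOn_stagePayoffSum u le_rfl h])
          (fun w w' h => by simp only [dependsOn_stagePayoffSum u le_rfl h]) fun w => ?_
        have h2 := hq (f (n + 1) (history (n + 1) w))
        rw [inner_mixedPayoff] at h2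
        simp_rw [stagePayoffSum_succ_update, inner_add_right, mul_neg, mul_add,
          Finset.sum_neg_distrib, Finset.sum_add_distrib, ← Finset.sum_mul, sum_sum_mul_eq_one,
          one_mul]
        linarith
      rw [integral_neg, integral_neg, integral_add (hint _) (integrable_const _)] at h1
      simp only [integral_const, probReal_univ, one_smul] at h1
      push_cast
      linarith
  -- For `n ≥ M` the lower bound `n * c - ‖x‖ * C` exceeds the upper bound `(n + 1) * (c / 2)`.
  obtain ⟨M, hM⟩ := exists_nat_gt ((c + 2 * (‖x‖ * C)) / c)
  set n := max N M with hn
  let E : Set (ℕ → A₁ × A₂) := {w | ε ≤ ‖averagePayoff u (n + 1) w‖}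
  have hE : MeasurableSet E := measurableSet_setOfPred.2 (measurable_of_dependsOn (n := n + 1)
    fun w w' h => by
      simp only [averagePayoff_eq, dependsOn_stagePayoffSum u le_rfl h])
  have hPE : P.real E ≤ ε := by
    refine ENNReal.toReal_le_of_le_ofReal hε.le (le_trans (measure_mono fun w hw => ?_) hg.le)
    exact ⟨n + 1, by omega, by simpa [E] using hw⟩
  have hup : ∫ w, inner ℝ x (stagePayoffSum u (n + 1) w) ∂P ≤
      (n + 1) * (‖x‖ * ε + ‖x‖ * C * P.real E) := by
    calc _ ≤ ∫ w, ((n + 1) * (‖x‖ * ε) + E.indicator (fun _ => (n + 1) * (‖x‖ * C)) w) ∂P := by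
          refine integral_mono (hint _)
            ((integrable_const _).add ((integrable_const _).indicator hE)) fun w => ?_
          by_cases hw : w ∈ E
          · have := (abs_le.1 (hinner (n + 1) w)).2
            simp only [Set.indicator_of_mem hw]
            push_cast at this
            have h0 : 0 ≤ ((n : ℝ) + 1) * (‖x‖ * ε) := by positivity
            linarith
          · simp only [Set.indicator_of_notMem hw, add_zero]
            have h1 : ‖averagePayoff u (n + 1) w‖ < ε := not_le.1 hw
            rw [averagePayoff_eq, norm_smul, norm_inv, Real.norm_natCast,
              inv_mul_lt_iff₀ (by positivity)] at h1
            push_cast at h1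
            have h2 := mul_le_mul_of_nonneg_left h1.le (norm_nonneg x)
            linarith [real_inner_le_norm x (stagePayoffSum u (n + 1) w)]
      _ = _ := by
          rw [integral_add (integrable_const _) ((integrable_const _).indicator hE),
            integral_indicator_const _ hE]
          simp only [integral_const, probReal_univ, smul_eq_mul]
          ring
  have h1 : ‖x‖ * ε + ‖x‖ * C * P.real E ≤ c / 2 := by
    have h2 : ‖x‖ * ε + ‖x‖ * C * P.real E ≤ (‖x‖ * (1 + C) + 1) * ε := by
      have := mul_le_mul_of_nonneg_left hPE (by positivity : 0 ≤ ‖x‖ * C)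
      nlinarith
    refine h2.trans (le_of_eq ?_)
    rw [hεdef]
    field_simp
  have h3 := (hlow n).trans (hup.trans (mul_le_mul_of_nonneg_left h1 (by positivity)))
  rw [div_lt_iff₀ hc] at hM
  have h4 : (M : ℝ) ≤ n := by exact_mod_cast le_max_right N M
  have h5 := mul_le_mul_of_nonneg_right h4 hc.le
  linarith

end Approachability

end VectorGame

theorem mainTheorem5 {A₁ A₂ : Type*} [Fintype A₁] [Fintype A₂] [Nonempty A₁] [Nonempty A₂]
    [MeasurableSpace A₁] [DiscreteMeasurableSpace A₁]
    [MeasurableSpace A₂] [DiscreteMeasurableSpace A₂]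
    (m : ℕ) (u : A₁ → A₂ → EuclideanSpace ℝ (Fin m)) :
    VectorGame.Attainable u 0 ↔ VectorGame.Approachable u 0 :=
  ⟨fun h => VectorGame.approachable_of_blackwellCondition
      (VectorGame.blackwellCondition_of_attainable h),
    fun h => VectorGame.attainable_of_blackwellCondition
      (VectorGame.blackwellCondition_of_approachable h)⟩
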